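/- Write $\mathbb{N}=\{1,2,\dots\}$. A sequence $(x_n)_{n\in\mathbb{N}}$ in $\mathbb{R}^k$ is called uniformly distributed in $\mathbb{T}^k$ (that is, modulo $1$) if for all intervals $I_1,\dots,I_k\subset[0,1]$, $$\lim_{N\to\infty}\frac1N\Big|\big\{n\in\{1,\dots,N\}:\{x_n\}\in I_1\times\cdots\times I_k\big\}\Big|=\mu(I_1\times\cdots\times I_k),$$ where $\mu$ is Lebesgue measure on $\mathbb{R}^k$ and $\{x_n\}$ is the vector of fractional parts of the coordinates of $x_n$. A sequence $a:\mathbb{N}\to\mathbb{R}$ is called scattered if for every $\delta\in(0,1]$ there exists $\epsilon>0$ such that for all sufficiently large $N$, $$\frac1{N^2}\sum_{1\le m<n\le N}\min\big(|a(n)-a(m)|^{-\delta},1\big)\le\frac1{(\log N)^{1+\epsilon}},$$ where the minimum is read as $1$ if $a(n)=a(m)$. Theorem. Let $k\in\mathbb{N}$ and let $p_1,\dots,p_k\in\mathbb{R}[x]$. Then the following are equivalent: (1) The polynomials $1,p_1,\dots,p_k$ are linearly independent over $\mathbb{R}$ (as a family, so that in particular they are pairwise distinct). (2) For all scattered sequences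 $a_1,\dots,a_k:\mathbb{N}\to\mathbb{R}$ and for Lebesgue-almost every $x\in\mathbb{R}$, the sequence $\big(a_1(n)p_1(x),\dots,a_k(n)p_k(x)\big)_{n\in\mathbb{N}}$ is uniformly distributed in $\mathbb{T}^k$. (The exceptional null set may depend on $a_1,\dots,a_k$.) -/

import Mathlib

open MeasureTheory Filter Topology Polynomial

/-- A sequence `x 1, x 2, …` in `ℝ^k` is uniformly distributed modulo 1: for all intervals
`I 1, …, I k ⊆ [0,1]` (open, closed, half-open or degenerate), the asymptotic frequency of the
`n ≥ 1` for which the vector of fractional parts of `x n` lies in the box `I 1 × ⋯ × I k` is the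
Lebesgue measure of that box. The sequence is indexed by `n ≥ 1`; the value `x 0` plays no role. -/
def UniformlyDistributedModOne {k : ℕ} (x : ℕ → Fin k → ℝ) : Prop :=
  ∀ I : Fin k → Set ℝ, (∀ i, (I i).OrdConnected ∧ I i ⊆ Set.Icc (0 : ℝ) 1) →
    Tendsto
      (fun N : ℕ =>
        (Set.ncard {n : ℕ | n ∈ Finset.Icc 1 N ∧ (fun i => Int.fract (x n i)) ∈ Set.univ.pi I} : ℝ)
          / (N : ℝ))
      atTop (𝓝 ((volume : Measure (Fin k → ℝ)).real (Set.univ.pi I)))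

/-- `min (|t|^(-δ), 1)` for `δ > 0`, where `|0|^(-δ) = +∞`, so that the value at `t = 0` is `1`
(the real power `0 ^ (-δ)` has the junk value `0`). -/
noncomputable def truncatedNegPow (δ t : ℝ) : ℝ :=
  open Classical in if t = 0 then 1 else min (|t| ^ (-δ)) 1

/-- A sequence `a 1, a 2, …` of reals is `δ`-scattered: there is `ε > 0` such that for all
sufficiently large `N`,
`N⁻² * ∑_{1 ≤ m < n ≤ N} min (|a n - a m|^(-δ), 1) ≤ 1 / (log N)^(1+ε)`.
The value `a 0` plays no role. -/
def IsDeltaScattered (δ : ℝ) (a : ℕ → ℝ) : Prop :=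
  ∃ ε : ℝ, 0 < ε ∧ ∀ᶠ N : ℕ in atTop,
    1 / (N : ℝ) ^ 2 *
        ∑ n ∈ Finset.Icc 1 N, ∑ m ∈ Finset.Ico 1 n, truncatedNegPow δ (a n - a m)
      ≤ 1 / Real.log N ^ (1 + ε)

/-- A sequence is scattered if it is `δ`-scattered for every `δ ∈ (0, 1]`. -/
def IsScattered (a : ℕ → ℝ) : Prop :=
  ∀ δ : ℝ, 0 < δ → δ ≤ 1 → IsDeltaScattered δ a

/-! Sufficiency rests on Weyl's criterion. It suffices that for each nonzero integer vector `h` and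
each of countably many bounded intervals exhausting the line, the averages of `exp (2πi ∑ h_j a_j(n)
p_j(x))` tend to 0 for almost every `x`. Expanding the `L²` norm of such an average gives a diagonal
term of order `1/N` and a mean over pairs `m < n` of oscillatory integrals with phase `∑ c_j p_j`,
where `c_j = 2π h_j (a_j(n) - a_j(m))`.

The key estimate (`exists_norm_integral_exp_le`) bounds such an integral by `C min(|c_i|^(-δ), 1)`
for every index `i`, with `C` and `δ` depending only on the polynomials and the interval.
Independence together with 1 makes `c ↦ (∑ c_j p_j)'` injective on a finite-dimensional space, so
the phase has a derivative of size at least comparable to `|c|` somewhere on the interval. By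
Lagrange interpolation a polynomial of bounded degree that is large at one point is small only on a
set of small measure, and integration by parts handles the rest.

Choosing `i` with `h_i ≠ 0`, scatteredness of `a_i` alone makes the mean over pairs `O((log
N)^(-1-ε))`. Together with `1/N` this is summable along `N = ⌊c^j⌋`, so the averages converge almost
everywhere along that subsequence. Letting `c` tend to 1 fills the gaps, because the terms are
bounded.

For necessity, a relation `g_0 + ∑ g_i p_i = 0` is exploited with `a_i(n) = d g_i 2^n`, where `d`
makes `d g_0` an integer. A fixed subsum of the coordinates is then always an integer, so for every
`x` the sequence misses a box of positive volume. -/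

/-! ### Weyl's criterion on the torus. -/

/-- The quotient map from `ℝ^k` to the torus. -/
noncomputable def torusMk {k : ℕ} (x : Fin k → ℝ) : UnitAddTorus (Fin k) := fun i => (x i : UnitAddCircle)

lemma continuous_torusMk {k : ℕ} : Continuous (torusMk (k := k)) :=
  continuous_pi fun i => (AddCircle.continuous_mk' 1).comp (continuous_apply i)

/-- The half-open unit cube. -/
def unitCube (k : ℕ) : Set (Fin k → ℝ) := Set.univ.pi fun _ => Set.Ico 0 1

/-- Lebesgue measure on the torus, as the image of Lebesgue measure on the unit cube. -/
noncomputable def torusMeasure (k : ℕ) : Measure (UnitAddTorus (Fin k)) :=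
  (volume.restrict (unitCube k)).map torusMk

lemma volume_restrict_unitCube (k : ℕ) :
    (volume : Measure (Fin k → ℝ)).restrict (unitCube k) =
      Measure.pi fun _ => (volume : Measure ℝ).restrict (Set.Ico 0 1) := by
  rw [unitCube, volume_pi, Measure.restrict_pi_pi]

instance isProbabilityMeasure_torusMeasure (k : ℕ) : IsProbabilityMeasure (torusMeasure k) := by
  have : IsProbabilityMeasure ((volume : Measure ℝ).restrict (Set.Ico 0 1)) := ⟨by simp⟩
  unfold torusMeasure
  rw [volume_restrict_unitCube]
  exact Measure.isProbabilityMeasure_map continuous_torusMk.aemeasurable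

lemma integral_Ico_fourier (n : ℤ) (hn : n ≠ 0) :
    ∫ x in Set.Ico (0 : ℝ) 1, (fourier n (x : UnitAddCircle) : ℂ) = 0 := by
  rw [integral_Ico_eq_integral_Ioc, ← intervalIntegral.integral_of_le zero_le_one]
  simp_rw [fourier_coe_apply]
  have hc : (2 * Real.pi * Complex.I * n : ℂ) ≠ 0 := by
    simp [Real.pi_ne_zero, Complex.I_ne_zero, hn]
  have := integral_exp_mul_complex (a := 0) (b := 1) hc
  simp only [Complex.ofReal_one, div_one]
  rw [this]
  have h1 : Complex.exp (2 * Real.pi * Complex.I * n) = 1 := by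
    rw [mul_comm]; exact Complex.exp_int_mul_two_pi_mul_I n
  simp [h1]

lemma integral_mFourier_torusMeasure {k : ℕ} (h : Fin k → ℤ) (hh : h ≠ 0) :
    ∫ t, UnitAddTorus.mFourier h t ∂(torusMeasure k) = 0 := by
  unfold torusMeasure
  rw [integral_map continuous_torusMk.aemeasurable
    (UnitAddTorus.mFourier h).continuous.aestronglyMeasurable, volume_restrict_unitCube]
  simp only [UnitAddTorus.mFourier, ContinuousMap.coe_mk, torusMk]
  rw [integral_fintype_prod_eq_prod (f := fun i (x : ℝ) => (fourier (h i) (x : UnitAddCircle) : ℂ))]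
  obtain ⟨i, hi⟩ := Function.ne_iff.mp hh
  exact Finset.prod_eq_zero (Finset.mem_univ i) (integral_Ico_fourier _ hi)

lemma mFourier_torusMk {k : ℕ} (h : Fin k → ℤ) (x : Fin k → ℝ) :
    UnitAddTorus.mFourier h (torusMk x) =
      Complex.exp (((2 * Real.pi * ∑ i, h i * x i : ℝ) : ℂ) * Complex.I) := by
  simp only [UnitAddTorus.mFourier, ContinuousMap.coe_mk, torusMk, fourier_coe_apply,
    ← Complex.exp_sum]
  congr 1
  push_cast
  rw [Finset.mul_sum, Finset.sum_mul]
  exact Finset.sum_congr rfl fun i _ => by ring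

/-- The representative in the unit cube. -/
noncomputable def torusRep {k : ℕ} (t : UnitAddTorus (Fin k)) : Fin k → ℝ :=
  fun i => (AddCircle.equivIco (1 : ℝ) 0 (t i) : ℝ)

lemma torusRep_torusMk {k : ℕ} (x : Fin k → ℝ) : torusRep (torusMk x) = fun i => Int.fract (x i) := by
  ext i
  simp [torusRep, torusMk, AddCircle.coe_equivIco_mk_apply]

lemma torusRep_torusMk_of_mem {k : ℕ} {x : Fin k → ℝ} (hx : x ∈ unitCube k) :
    torusRep (torusMk x) = x := by
  rw [torusRep_torusMk]
  ext i
  exact Int.fract_eq_self.mpr (hx i trivial)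

lemma measurable_torusRep {k : ℕ} : Measurable (torusRep (k := k)) :=
  measurable_pi_lambda _ fun i =>
    (measurable_subtype_coe.comp (AddCircle.measurableEquivIco 1 0).measurable).comp
      (measurable_pi_apply i)

lemma measurableSet_torusRep_preimage {k : ℕ} {I : Fin k → Set ℝ}
    (hI : ∀ i, (I i).OrdConnected) :
    MeasurableSet (torusRep ⁻¹' Set.univ.pi I : Set (UnitAddTorus (Fin k))) :=
  measurable_torusRep (MeasurableSet.univ_pi fun i => (hI i).measurableSet)

lemma continuousAt_torusRep {k : ℕ} {x : Fin k → ℝ} (hx : x ∈ unitCube k) (h0 : ∀ i, x i ≠ 0) :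
    ContinuousAt torusRep (torusMk x) := by
  refine continuousAt_pi.mpr fun i => ?_
  have hne : (x i : UnitAddCircle) ≠ ((0 : ℝ) : UnitAddCircle) := by
    intro h
    rw [AddCircle.coe_eq_coe_iff_of_mem_Ico (a := 0)] at h
    · exact h0 i h
    · simpa using hx i trivial
    · simp
  have h1 : ContinuousAt (AddCircle.equivIco (1 : ℝ) 0) (torusMk x i) :=
    AddCircle.continuousAt_equivIco 1 0 hne
  exact continuous_subtype_val.continuousAt.comp
    (ContinuousAt.comp (f := fun t : UnitAddTorus (Fin k) => t i) h1 (continuous_apply i).continuousAt)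

/-- `torusRep` can jump only where some coordinate is 0. Elsewhere a point whose coordinates avoid
the endpoints of the intervals is interior or exterior to the box, so the frontier lies over
finitely many null sets. This is the hypothesis of the portmanteau theorem. -/
lemma torusMeasure_frontier {k : ℕ} (I : Fin k → Set ℝ) (hI : ∀ i, (I i).OrdConnected) :
    torusMeasure k (frontier (torusRep ⁻¹' Set.univ.pi I)) = 0 := by
  unfold torusMeasure
  rw [Measure.map_apply continuous_torusMk.measurable isClosed_frontier.measurableSet,
    Measure.restrict_apply (continuous_torusMk.measurable isClosed_frontier.measurableSet)]
  refine measure_mono_null (t := ⋃ i, Function.eval i ⁻¹' (frontier (I i) ∪ {0})) ?_ ?_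
  · rintro x ⟨hx, hxc⟩
    by_contra hcon
    simp only [Set.mem_iUnion, Set.mem_preimage, Function.eval, Set.mem_union,
      Set.mem_singleton_iff, not_exists, not_or] at hcon
    have hcont := continuousAt_torusRep hxc fun i => (hcon i).2
    have hval := torusRep_torusMk_of_mem hxc
    rw [Set.mem_preimage, frontier_eq_closure_inter_closure] at hx
    by_cases hall : ∀ i, x i ∈ interior (I i)
    · have : Set.univ.pi I ∈ 𝓝 (torusRep (torusMk x)) := by
        rw [hval]
        exact set_pi_mem_nhds Set.finite_univ fun i _ => mem_interior_iff_mem_nhds.mp (hall i)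
      have h2 := hcont this
      rw [closure_compl] at hx
      exact hx.2 (mem_interior_iff_mem_nhds.mpr h2)
    · push Not at hall
      obtain ⟨i, hi⟩ := hall
      have hc : x i ∉ closure (I i) := fun h => (hcon i).1 ⟨h, hi⟩
      have : (Function.eval i ⁻¹' (closure (I i))ᶜ : Set (Fin k → ℝ)) ∈
          𝓝 (torusRep (torusMk x)) := by
        rw [hval]
        exact (isClosed_closure.isOpen_compl.preimage (continuous_apply i)).mem_nhds hc
      obtain ⟨y, hy1, hy2⟩ := mem_closure_iff_nhds.mp hx.1 _ (hcont this)
      exact hy1 (subset_closure (hy2 i trivial))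
  · refine measure_iUnion_null fun i => ?_
    have hn : (volume : Measure ℝ) (frontier (I i) ∪ {0}) = 0 :=
      measure_union_null ((hI i).convex.addHaar_frontier volume) (by simp)
    exact (Measure.quasiMeasurePreserving_eval (μ := fun _ : Fin k => (volume : Measure ℝ)) i).preimage_null hn

lemma torusMeasure_box {k : ℕ} (I : Fin k → Set ℝ)
    (hI : ∀ i, (I i).OrdConnected ∧ I i ⊆ Set.Icc (0 : ℝ) 1) :
    torusMeasure k (torusRep ⁻¹' Set.univ.pi I) = volume (Set.univ.pi I) := by
  have hm := measurableSet_torusRep_preimage fun i => (hI i).1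
  unfold torusMeasure
  rw [Measure.map_apply continuous_torusMk.measurable hm,
    Measure.restrict_apply (continuous_torusMk.measurable hm)]
  have : torusMk ⁻¹' (torusRep ⁻¹' Set.univ.pi I) ∩ unitCube k =
      Set.univ.pi fun i => I i ∩ Set.Ico 0 1 := by
    ext x
    rw [Set.pi_inter_distrib]
    constructor
    · rintro ⟨h1, h2⟩
      refine ⟨?_, h2⟩
      rwa [Set.mem_preimage, Set.mem_preimage, torusRep_torusMk_of_mem h2] at h1
    · rintro ⟨h1, h2⟩
      refine ⟨?_, h2⟩
      rwa [Set.mem_preimage, Set.mem_preimage, torusRep_torusMk_of_mem h2]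
  rw [this, volume_pi_pi, volume_pi_pi]
  refine Finset.prod_congr rfl fun i _ => ?_
  refine measure_congr ?_
  have h1 : (I i ∩ Set.Icc (0 : ℝ) 1) = I i := Set.inter_eq_left.mpr (hI i).2
  conv_rhs => rw [← h1]
  -- The endpoint 1 may belong to `I i` but is never a fractional part; it is a null set.
  exact (ae_eq_refl (I i)).inter Ico_ae_eq_Icc

/-- The empirical measure of the first `N + 1` terms. -/
noncomputable def empiricalMeasure {k : ℕ} (x : ℕ → Fin k → ℝ) (N : ℕ) :
    Measure (UnitAddTorus (Fin k)) :=
  ((N + 1 : ℕ) : ENNReal)⁻¹ • ∑ n ∈ Finset.Icc 1 (N + 1), Measure.dirac (torusMk (x n))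

instance isProbabilityMeasure_empiricalMeasure {k : ℕ} (x : ℕ → Fin k → ℝ) (N : ℕ) :
    IsProbabilityMeasure (empiricalMeasure x N) := by
  constructor
  simp only [empiricalMeasure, Measure.smul_apply, Measure.coe_finsetSum, Finset.sum_apply,
    measure_univ, Finset.sum_const, Nat.card_Icc, smul_eq_mul, nsmul_eq_mul, mul_one]
  exact ENNReal.inv_mul_cancel (by simp) (ENNReal.natCast_ne_top _)

lemma integral_empiricalMeasure {k : ℕ} (x : ℕ → Fin k → ℝ) (N : ℕ)
    (f : C(UnitAddTorus (Fin k), ℂ)) :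
    ∫ t, f t ∂(empiricalMeasure x N) =
      (∑ n ∈ Finset.Icc 1 (N + 1), f (torusMk (x n))) / ((N + 1 : ℕ) : ℂ) := by
  rw [empiricalMeasure, integral_smul_measure, integral_finsetSum_measure]
  · simp only [integral_dirac]
    rw [ENNReal.toReal_inv, ENNReal.toReal_natCast, div_eq_inv_mul, Complex.real_smul]
    push_cast
    rfl
  · intro n _
    exact integrable_dirac (by simp)

lemma empiricalMeasure_real_apply {k : ℕ} (x : ℕ → Fin k → ℝ) (N : ℕ)
    (I : Fin k → Set ℝ) (hI : ∀ i, (I i).OrdConnected) :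
    (empiricalMeasure x N).real (torusRep ⁻¹' Set.univ.pi I) =
      (Set.ncard {n : ℕ | n ∈ Finset.Icc 1 (N + 1) ∧
        (fun i => Int.fract (x n i)) ∈ Set.univ.pi I} : ℝ) / ((N + 1 : ℕ) : ℝ) := by
  classical
  have hm := measurableSet_torusRep_preimage hI
  have hs : {n : ℕ | n ∈ Finset.Icc 1 (N + 1) ∧ (fun i => Int.fract (x n i)) ∈ Set.univ.pi I} =
      ((Finset.Icc 1 (N + 1)).filter
        fun n => (fun i => Int.fract (x n i)) ∈ Set.univ.pi I : Finset ℕ) := by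
    ext n; simp
  rw [hs, Set.ncard_coe_finset, Measure.real, empiricalMeasure]
  simp only [Measure.smul_apply, Measure.coe_finsetSum, Finset.sum_apply,
    Measure.dirac_apply' _ hm, smul_eq_mul, Set.indicator_apply, Set.mem_preimage,
    torusRep_torusMk, Pi.one_apply]
  rw [Finset.sum_boole, ENNReal.toReal_mul, ENNReal.toReal_inv, ENNReal.toReal_natCast,
    ENNReal.toReal_natCast, div_eq_inv_mul]

/-- The hypothesis gives the limit on characters, linearity extends it to trigonometric polynomials,
and their sup-norm density extends it to all continuous functions, since all the measures have mass
1. -/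
lemma tendsto_integral_empiricalMeasure {k : ℕ} (x : ℕ → Fin k → ℝ)
    (hx : ∀ h : Fin k → ℤ, h ≠ 0 → Tendsto (fun N : ℕ =>
      (∑ n ∈ Finset.Icc 1 N,
        Complex.exp (((2 * Real.pi * ∑ i, h i * x n i : ℝ) : ℂ) * Complex.I)) / (N : ℂ))
      atTop (𝓝 0)) (f : C(UnitAddTorus (Fin k), ℂ)) :
    Tendsto (fun N => ∫ t, f t ∂(empiricalMeasure x N)) atTop (𝓝 (∫ t, f t ∂(torusMeasure k))) := by
  have hint : ∀ (μ : Measure (UnitAddTorus (Fin k))) [IsProbabilityMeasure μ]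
      (g : C(UnitAddTorus (Fin k), ℂ)), Integrable g μ := fun μ _ g =>
    g.continuous.integrable_of_hasCompactSupport (HasCompactSupport.of_compactSpace _)
  have hspan : ∀ g ∈ Submodule.span ℂ (Set.range (UnitAddTorus.mFourier (d := Fin k))),
      Tendsto (fun N => ∫ t, g t ∂(empiricalMeasure x N)) atTop
        (𝓝 (∫ t, g t ∂(torusMeasure k))) := by
    intro g hg
    induction hg using Submodule.span_induction with
    | mem g hg =>
      obtain ⟨h, rfl⟩ := hg
      by_cases hh : h = 0
      · subst hh
        simp [UnitAddTorus.mFourier_zero]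
      · rw [integral_mFourier_torusMeasure h hh]
        have := (hx h hh).comp (tendsto_add_atTop_nat 1)
        refine this.congr fun N => ?_
        rw [integral_empiricalMeasure]
        simp only [Function.comp, mFourier_torusMk]
    | zero => simp
    | add g₁ g₂ _ _ h₁ h₂ =>
      simp only [ContinuousMap.add_apply]
      rw [integral_add (hint _ g₁) (hint _ g₂)]
      refine (h₁.add h₂).congr fun N => ?_
      rw [integral_add (hint _ g₁) (hint _ g₂)]
    | smul c g _ h₁ =>
      simp only [ContinuousMap.smul_apply]
      rw [integral_smul]
      refine (h₁.const_smul c).congr fun N => ?_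
      rw [integral_smul]
  have hclose : ∀ (μ : Measure (UnitAddTorus (Fin k))) [IsProbabilityMeasure μ]
      (g : C(UnitAddTorus (Fin k), ℂ)), dist (∫ t, f t ∂μ) (∫ t, g t ∂μ) ≤ dist f g := by
    intro μ _ g
    rw [dist_eq_norm, ← integral_sub (hint μ f) (hint μ g)]
    refine (norm_integral_le_of_norm_le_const (C := dist f g) (ae_of_all _ fun t => ?_)).trans
      (by simp)
    rw [← dist_eq_norm]
    exact ContinuousMap.dist_apply_le_dist t
  rw [Metric.tendsto_atTop]
  intro ε hε
  have hf : f ∈ closure (Submodule.span ℂ (Set.range (UnitAddTorus.mFourier (d := Fin k))) :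
      Set C(UnitAddTorus (Fin k), ℂ)) := by
    rw [← Submodule.topologicalClosure_coe, UnitAddTorus.span_mFourier_closure_eq_top]
    trivial
  obtain ⟨g, hg, hfg⟩ := Metric.mem_closure_iff.mp hf (ε / 3) (by positivity)
  obtain ⟨N₀, hN₀⟩ := Metric.tendsto_atTop.mp (hspan g hg) (ε / 3) (by positivity)
  refine ⟨N₀, fun N hN => ?_⟩
  have h1 := hclose (empiricalMeasure x N) g
  have h2 := hclose (torusMeasure k) g
  have h3 := hN₀ N hN
  rw [dist_comm] at h2
  calc _ ≤ _ := dist_triangle4 _ (∫ t, g t ∂(empiricalMeasure x N)) (∫ t, g t ∂(torusMeasure k)) _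
    _ < ε := by linarith

/-- Weyl's criterion. -/
theorem uniformlyDistributedModOne_of_weyl {k : ℕ} (x : ℕ → Fin k → ℝ)
    (hx : ∀ h : Fin k → ℤ, h ≠ 0 → Tendsto (fun N : ℕ =>
      (∑ n ∈ Finset.Icc 1 N,
        Complex.exp (((2 * Real.pi * ∑ i, h i * x n i : ℝ) : ℂ) * Complex.I)) / (N : ℂ))
      atTop (𝓝 0)) : UniformlyDistributedModOne x := by
  intro I hI
  let μ : ℕ → ProbabilityMeasure (UnitAddTorus (Fin k)) := fun N => ⟨empiricalMeasure x N, inferInstance⟩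
  let ν : ProbabilityMeasure (UnitAddTorus (Fin k)) := ⟨torusMeasure k, inferInstance⟩
  have hlim : Tendsto μ atTop (𝓝 ν) := by
    rw [ProbabilityMeasure.tendsto_iff_forall_integral_rclike_tendsto ℂ]
    intro f
    exact tendsto_integral_empiricalMeasure x hx f.toContinuousMap
  have key := ProbabilityMeasure.tendsto_measure_of_null_frontier_of_tendsto' hlim
    (torusMeasure_frontier I fun i => (hI i).1)
  have hfin : torusMeasure k (torusRep ⁻¹' Set.univ.pi I) ≠ ⊤ := measure_ne_top _ _
  have key2 := (ENNReal.tendsto_toReal hfin).comp key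
  rw [torusMeasure_box I hI] at key2
  -- `empiricalMeasure x N` averages `N + 1` terms, which makes it a probability measure for every
  -- `N`; hence the shift.
  rw [← tendsto_add_atTop_iff_nat 1]
  refine key2.congr fun N => ?_
  exact empiricalMeasure_real_apply x N I fun i => (hI i).1

/-! ### Sublevel sets of polynomials and oscillatory integrals. -/

/-- A set of large measure contains many separated points. -/
lemma exists_separated_finset (s : ℝ) (hs : 0 < s) (n : ℕ) (E : Set ℝ)
    (hE : ENNReal.ofReal (n * (2 * s)) < volume E) :
    ∃ t : Finset ℝ, (t : Set ℝ) ⊆ E ∧ t.card = n + 1 ∧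
      ∀ x ∈ t, ∀ y ∈ t, x ≠ y → s ≤ |x - y| := by
  induction n generalizing E with
  | zero =>
    have hne : E.Nonempty := nonempty_of_measure_ne_zero (μ := volume) (by
      intro h; rw [h] at hE; exact not_lt_bot hE)
    obtain ⟨x, hx⟩ := hne
    exact ⟨{x}, by simpa using hx, by simp, by simp⟩
  | succ n ih =>
    have hne : E.Nonempty := nonempty_of_measure_ne_zero (μ := volume) (by
      intro h; rw [h] at hE; exact not_lt_bot hE)
    obtain ⟨x, hx⟩ := hne
    -- Greedy choice: deleting the ball of radius `s` about `x` costs measure at most `2s` and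
    -- leaves only points at distance at least `s` from `x`.
    have hlt : ENNReal.ofReal (n * (2 * s)) < volume (E \ Metric.ball x s) := by
      refine lt_of_lt_of_le ?_ (le_measure_sdiff (μ := volume) (s₁ := E) (s₂ := Metric.ball x s))
      rw [Real.volume_ball, lt_tsub_iff_right, ← ENNReal.ofReal_add (by positivity) (by positivity)]
      convert hE using 2
      push_cast; ring
    obtain ⟨t, htE, htc, hts⟩ := ih _ hlt
    have hdist : ∀ y ∈ t, s ≤ |y - x| := fun y hy => by
      have := (htE hy).2
      rwa [Metric.mem_ball, not_lt, Real.dist_eq] at this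
    have hxt : x ∉ t := fun h => by
      have := hdist x h
      simp at this; linarith
    refine ⟨insert x t, ?_, by rw [Finset.card_insert_of_notMem hxt, htc], ?_⟩
    · intro y hy
      rcases Finset.mem_insert.mp hy with rfl | hy
      · exact hx
      · exact (htE hy).1
    · intro y hy z hz hyz
      rcases Finset.mem_insert.mp hy with rfl | hy' <;> rcases Finset.mem_insert.mp hz with rfl | hz'
      · exact absurd rfl hyz
      · rw [abs_sub_comm]; exact hdist z hz'
      · exact hdist y hy'
      · exact hts y hy' z hz' hyz

/-- A polynomial that is small at separated points of an interval is small on the interval. -/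
lemma abs_eval_le_of_separated {a b s σ : ℝ} (hs : 0 < s) {D : ℕ} (r : ℝ[X])
    (hr : r.natDegree ≤ D) (t : Finset ℝ) (ht : (t : Set ℝ) ⊆ Set.Icc a b) (htc : t.card = D + 1)
    (hsep : ∀ x ∈ t, ∀ y ∈ t, x ≠ y → s ≤ |x - y|) (hsmall : ∀ x ∈ t, |r.eval x| ≤ σ)
    {y : ℝ} (hy : y ∈ Set.Icc a b) :
    |r.eval y| ≤ (D + 1) * (((b - a) / s) ^ D * σ) := by
  have hdeg : r.degree < t.card := by
    rw [htc]
    exact (Polynomial.degree_le_of_natDegree_le hr).trans_lt (by exact_mod_cast Nat.lt_succ_self D)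
  -- Each of the `D + 1` Lagrange basis polynomials is a product of `D` factors of size at most `(b
  -- - a) / s`.
  have hint := Lagrange.eq_interpolate (v := id) (s := t) (Set.injOn_id _) hdeg
  have hev : r.eval y = ∑ i ∈ t, r.eval i * ∏ j ∈ t.erase i, ((i - j)⁻¹ * (y - j)) := by
    conv_lhs => rw [hint]
    simp [Lagrange.interpolate_apply, eval_finsetSum, Lagrange.basis, eval_prod,
      Lagrange.basisDivisor]
  rw [hev]
  refine (Finset.abs_sum_le_sum_abs _ _).trans ?_
  refine (Finset.sum_le_card_nsmul t _ (((b - a) / s) ^ D * σ) fun i hi => ?_).trans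
    (by rw [htc, nsmul_eq_mul]; push_cast; exact le_rfl)
  rw [abs_mul, mul_comm, Finset.abs_prod]
  refine mul_le_mul ?_ (hsmall i hi) (abs_nonneg _) ?_
  · have hcard : (t.erase i).card = D := by rw [Finset.card_erase_of_mem hi, htc]; rfl
    refine (Finset.prod_le_prod (g := fun _ => (b - a) / s) ?_ ?_).trans_eq (by
      rw [Finset.prod_const, hcard])
    · intro j _; positivity
    · intro j hj
      have hji := Finset.mem_erase.mp hj
      rw [abs_mul, abs_inv, inv_mul_eq_div]
      refine div_le_div₀ ?_ ?_ hs (hsep i hi j hji.2 hji.1.symm)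
      · linarith [hy.1, hy.2]
      · have := ht hji.2
        rw [abs_le]; constructor <;> linarith [hy.1, hy.2, this.1, this.2]
  · have : 0 ≤ b - a := by linarith [hy.1, hy.2]
    positivity

/-- Sublevel set estimate for polynomials. -/
lemma volume_sublevel_le {a b s σ : ℝ} (hs : 0 < s) {D : ℕ} (r : ℝ[X])
    (hr : r.natDegree ≤ D) {y : ℝ} (hy : y ∈ Set.Icc a b)
    (hlt : (D + 1) * (((b - a) / s) ^ D * σ) < |r.eval y|) :
    volume.real {x ∈ Set.Icc a b | |r.eval x| ≤ σ} ≤ D * (2 * s) := by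
  by_contra! hcon
  rw [Measure.real, ← ENNReal.ofReal_lt_iff_lt_toReal (by positivity)
    (measure_ne_top_of_subset (Set.sep_subset _ _) (by simp))] at hcon
  obtain ⟨t, htE, htc, hts⟩ := exists_separated_finset s hs D _ hcon
  exact absurd (abs_eval_le_of_separated hs r hr t (fun x hx => (htE hx).1) htc hts
    (fun x hx => (htE hx).2) hy) (not_le.mpr hlt)

/-- The integrand is at most 1 on the sublevel set and at most `ρ² / σ²` off it. -/
lemma integral_cutoff_le {a b ρ σ : ℝ} (hab : a ≤ b) (hρ : 0 < ρ) (hσ : 0 < σ) (r : ℝ[X]) :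
    ∫ x in a..b, ρ ^ 2 / (r.eval x ^ 2 + ρ ^ 2) ≤
      volume.real {x ∈ Set.Icc a b | |r.eval x| ≤ σ} + (b - a) * (ρ ^ 2 / σ ^ 2) := by
  set E := {x ∈ Set.Icc a b | |r.eval x| ≤ σ} with hE
  have hEm : MeasurableSet E := by
    have : IsClosed E := isClosed_Icc.inter (isClosed_le r.continuous.abs continuous_const)
    exact this.measurableSet
  have hEsub : E ⊆ Set.Icc a b := Set.sep_subset _ _
  have hcont : Continuous fun x => ρ ^ 2 / (r.eval x ^ 2 + ρ ^ 2) :=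
    continuous_const.div (by fun_prop) fun x => by positivity
  rw [intervalIntegral.integral_of_le hab, ← integral_Icc_eq_integral_Ioc]
  have hind : Integrable (E.indicator fun _ => (1 : ℝ)) (volume.restrict (Set.Icc a b)) :=
    (integrable_const _).indicator hEm
  calc _ ≤ ∫ x in Set.Icc a b, (E.indicator (fun _ => (1 : ℝ)) x + ρ ^ 2 / σ ^ 2) := by
        refine setIntegral_mono_on (hcont.continuousOn.integrableOn_Icc)
          (hind.add (integrable_const _)) measurableSet_Icc fun x hx => ?_
        by_cases hxE : x ∈ E
        · rw [Set.indicator_of_mem hxE]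
          have : ρ ^ 2 / (r.eval x ^ 2 + ρ ^ 2) ≤ 1 := by
            rw [div_le_one (by positivity)]; nlinarith [sq_nonneg (r.eval x)]
          have : 0 ≤ ρ ^ 2 / σ ^ 2 := by positivity
          linarith
        · rw [Set.indicator_of_notMem hxE, zero_add]
          have h1 : σ < |r.eval x| := by
            by_contra! h; exact hxE ⟨hx, h⟩
          refine div_le_div_of_nonneg_left (by positivity) (by positivity) ?_
          have : σ ^ 2 ≤ r.eval x ^ 2 := by
            rw [← sq_abs (r.eval x)]; gcongr
          nlinarith [sq_nonneg ρ]
    _ = _ := by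
        rw [integral_add hind (integrable_const _), integral_indicator hEm, setIntegral_const,
          measureReal_restrict_apply hEm, Set.inter_eq_left.mpr hEsub]
        simp [hab]

/-- Integration by parts against a smooth cutoff of the stationary points. -/
lemma norm_integral_exp_le {a b ρ M : ℝ} (hab : a ≤ b) (hρ : 0 < ρ) (q : ℝ[X])
    (hM : ∀ x ∈ Set.Icc a b, |(derivative (derivative q)).eval x| ≤ M) :
    ‖∫ x in a..b, Complex.exp (((q.eval x : ℝ) : ℂ) * Complex.I)‖ ≤
      1 / ρ + M / ρ ^ 2 * (b - a) +
        ∫ x in a..b, ρ ^ 2 / ((derivative q).eval x ^ 2 + ρ ^ 2) := by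
  set r := derivative q with hr
  set e : ℝ → ℂ := fun x => Complex.exp (((q.eval x : ℝ) : ℂ) * Complex.I) with he
  -- `G` regularises `1 / r`: it satisfies `r G = 1 - ρ² / (r² + ρ²)` and is bounded by `1 / (2ρ)`
  -- even at zeros of `r`.
  set G : ℝ → ℝ := fun x => r.eval x / (r.eval x ^ 2 + ρ ^ 2) with hG
  set G' : ℝ → ℝ := fun x => (derivative r).eval x * (ρ ^ 2 - r.eval x ^ 2) /
    (r.eval x ^ 2 + ρ ^ 2) ^ 2 with hG'
  have hpos : ∀ x, 0 < r.eval x ^ 2 + ρ ^ 2 := fun x => by positivity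
  have hecont : Continuous e := by
    exact Complex.continuous_exp.comp ((Complex.continuous_ofReal.comp q.continuous).mul continuous_const)
  have hGcont : Continuous G := r.continuous.div (by fun_prop) fun x => (hpos x).ne'
  have hG'cont : Continuous G' :=
    ((derivative r).continuous.mul (by fun_prop)).div (by fun_prop) fun x => (pow_pos (hpos x) 2).ne'
  have hCcont : Continuous fun x => ρ ^ 2 / (r.eval x ^ 2 + ρ ^ 2) :=
    continuous_const.div (by fun_prop) fun x => (hpos x).ne'
  have hGd : ∀ x, HasDerivAt G (G' x) x := fun x => by
    have h1 := r.hasDerivAt x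
    have h2 := (h1.pow 2).add_const (ρ ^ 2)
    have h3 := h1.div h2 (hpos x).ne'
    exact h3.congr_deriv (by simp [hG']; ring)
  have hed : ∀ x, HasDerivAt e (e x * (((r.eval x : ℝ) : ℂ) * Complex.I)) x := fun x =>
    ((q.hasDerivAt x).ofReal_comp.mul_const Complex.I).cexp
  have hFd : ∀ x, HasDerivAt (fun x => e x * (G x : ℂ))
      (e x * (((r.eval x : ℝ) : ℂ) * Complex.I) * (G x : ℂ) + e x * (G' x : ℂ)) x := fun x =>
    (hed x).mul (hGd x).ofReal_comp
  have hc1 : Continuous fun x => e x * (((r.eval x : ℝ) : ℂ) * Complex.I) * (G x : ℂ) :=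
    (hecont.mul ((Complex.continuous_ofReal.comp r.continuous).mul continuous_const)).mul
      (Complex.continuous_ofReal.comp hGcont)
  have hc2 : Continuous fun x => e x * (G' x : ℂ) :=
    hecont.mul (Complex.continuous_ofReal.comp hG'cont)
  have hc3 : Continuous fun x => e x * ((ρ ^ 2 / (r.eval x ^ 2 + ρ ^ 2) : ℝ) : ℂ) :=
    hecont.mul (Complex.continuous_ofReal.comp hCcont)
  have hftc := intervalIntegral.integral_eq_sub_of_hasDerivAt (a := a) (b := b)
    (fun x _ => hFd x) ((hc1.add hc2).intervalIntegrable a b)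
  rw [intervalIntegral.integral_add (hc1.intervalIntegrable a b) (hc2.intervalIntegrable a b)] at hftc
  -- Since `e' = i r e`, this writes `e` as `-i e' G` plus a part concentrated where `r` is small;
  -- the first is integrated by parts.
  have hdecomp : ∀ x, e x = -Complex.I * (e x * (((r.eval x : ℝ) : ℂ) * Complex.I) * (G x : ℂ)) +
      e x * ((ρ ^ 2 / (r.eval x ^ 2 + ρ ^ 2) : ℝ) : ℂ) := fun x => by
    have h0 : (((r.eval x : ℝ) : ℂ) ^ 2 + (ρ : ℂ) ^ 2) ≠ 0 := by
      exact_mod_cast (hpos x).ne'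
    simp only [hG]
    push_cast
    field_simp
    ring_nf
    rw [Complex.I_sq]; ring
  have hen : ∀ x, ‖e x‖ = 1 := fun x => Complex.norm_exp_ofReal_mul_I _
  have hGb : ∀ x, |G x| ≤ 1 / ρ / 2 := fun x => by
    simp only [hG]
    rw [abs_div, abs_of_pos (hpos x), div_le_iff₀ (hpos x), ← sq_abs (r.eval x)]
    rw [div_div, div_mul_eq_mul_div, one_mul, le_div_iff₀ (by positivity)]
    nlinarith [sq_nonneg (|r.eval x| - ρ)]
  have hG'b : ∀ x ∈ Set.Icc a b, |G' x| ≤ M / ρ ^ 2 := fun x hx => by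
    have hM0 : 0 ≤ M := (abs_nonneg _).trans (hM x hx)
    simp only [hG']
    rw [abs_div, abs_mul, abs_of_pos (pow_pos (hpos x) 2)]
    have h1 : |ρ ^ 2 - r.eval x ^ 2| ≤ r.eval x ^ 2 + ρ ^ 2 := by
      rw [abs_le]; constructor <;> nlinarith [sq_nonneg (r.eval x), sq_nonneg ρ]
    have h2 : ρ ^ 2 ≤ r.eval x ^ 2 + ρ ^ 2 := by nlinarith [sq_nonneg (r.eval x)]
    calc _ ≤ M * (r.eval x ^ 2 + ρ ^ 2) / (r.eval x ^ 2 + ρ ^ 2) ^ 2 := by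
          gcongr; exact hM x hx
      _ = M / (r.eval x ^ 2 + ρ ^ 2) := by
          have := (hpos x).ne'; field_simp
      _ ≤ _ := by gcongr
  have hc4 : Continuous fun x => -Complex.I * (e x * (((r.eval x : ℝ) : ℂ) * Complex.I) * (G x : ℂ)) :=
    continuous_const.mul hc1
  have h1 : ∫ x in a..b, e x = -Complex.I *
      (e b * (G b : ℂ) - e a * (G a : ℂ) - ∫ x in a..b, e x * (G' x : ℂ)) +
      ∫ x in a..b, e x * ((ρ ^ 2 / (r.eval x ^ 2 + ρ ^ 2) : ℝ) : ℂ) := by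
    rw [← hftc, add_sub_cancel_right, ← intervalIntegral.integral_const_mul,
      ← intervalIntegral.integral_add (hc4.intervalIntegrable a b)
        (hc3.intervalIntegrable a b)]
    exact intervalIntegral.integral_congr fun x _ => hdecomp x
  rw [h1]
  have hI1 : ‖∫ x in a..b, e x * (G' x : ℂ)‖ ≤ M / ρ ^ 2 * (b - a) := by
    have := intervalIntegral.norm_integral_le_of_norm_le_const (a := a) (b := b)
      (f := fun x => e x * (G' x : ℂ)) (C := M / ρ ^ 2) fun x hx => by
        rw [Set.uIoc_of_le hab] at hx
        rw [norm_mul, hen, one_mul, Complex.norm_real]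
        exact hG'b x ⟨hx.1.le, hx.2⟩
    rwa [abs_of_nonneg (sub_nonneg.mpr hab)] at this
  have hI2 : ‖∫ x in a..b, e x * ((ρ ^ 2 / (r.eval x ^ 2 + ρ ^ 2) : ℝ) : ℂ)‖ ≤
      ∫ x in a..b, ρ ^ 2 / (r.eval x ^ 2 + ρ ^ 2) := by
    refine (intervalIntegral.norm_integral_le_integral_norm hab).trans_eq ?_
    refine intervalIntegral.integral_congr fun x _ => ?_
    rw [norm_mul, hen, one_mul, Complex.norm_real, Real.norm_of_nonneg]
    positivity
  have hb1 : ∀ x, ‖e x * (G x : ℂ)‖ ≤ 1 / ρ / 2 := fun x => by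
    rw [norm_mul, hen, one_mul, Complex.norm_real]; exact hGb x
  refine (norm_add_le _ _).trans (add_le_add ?_ hI2)
  rw [norm_mul, norm_neg, Complex.norm_I, one_mul]
  refine (norm_sub_le _ _).trans (add_le_add ?_ hI1)
  refine (norm_sub_le _ _).trans ?_
  linarith [hb1 a, hb1 b]

/-- The choices are `ρ = T^(5D)`, `σ = T^(6D)` and separation `s = (b - a) / T`. The sublevel
estimate then requires `(D + 1) T^(7D) < T^(8D)`, which is the hypothesis on `T^D`. The errors
`1/ρ`, `T^(8D)/ρ²` and `ρ²/σ²` are `T^(-5D)`, `T^(-2D)` and `T^(-2D)`, all at most `1/T`; the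
sublevel set itself contributes `2D(b - a)/T`. -/
lemma norm_integral_exp_le_div {a b T K : ℝ} (hab : a < b) {D : ℕ} (hD : 1 ≤ D)
    (hT : 1 ≤ T) (hDT : D + 1 < T ^ D) (q : ℝ[X]) (hq : (derivative q).natDegree ≤ D)
    {y : ℝ} (hy : y ∈ Set.Icc a b) (hyT : |(derivative q).eval y| = T ^ (8 * D)) (hK : 0 ≤ K)
    (hM : ∀ x ∈ Set.Icc a b, |(derivative (derivative q)).eval x| ≤ K * T ^ (8 * D)) :
    ‖∫ x in a..b, Complex.exp (((q.eval x : ℝ) : ℂ) * Complex.I)‖ ≤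
      (1 + K * (b - a) + 2 * D * (b - a) + (b - a)) / T := by
  have hT0 : 0 < T := by linarith
  have hL : 0 < b - a := sub_pos.mpr hab
  have hρ : 0 < T ^ (5 * D) := by positivity
  have hσ : 0 < T ^ (6 * D) := by positivity
  have hsub := volume_sublevel_le (s := (b - a) / T) (σ := T ^ (6 * D)) (by positivity)
    (derivative q) hq hy (by
      rw [hyT, div_div_cancel₀ hL.ne', ← pow_add]
      have : T ^ (8 * D) = T ^ D * T ^ (D + 6 * D) := by rw [← pow_add]; congr 1; ring
      rw [this]
      gcongr)
  have h1 := norm_integral_exp_le hab.le hρ q hM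
  have h2 := integral_cutoff_le hab.le hρ hσ (derivative q)
  have e1 : 1 / T ^ (5 * D) ≤ 1 / T := by
    gcongr; exact le_self_pow₀ hT (by omega)
  have hTT : T ≤ T ^ (2 * D) := le_self_pow₀ hT (by omega)
  have e2 : K * T ^ (8 * D) / (T ^ (5 * D)) ^ 2 ≤ K / T := by
    have : (T ^ (5 * D)) ^ 2 = T ^ (8 * D) * T ^ (2 * D) := by
      rw [← pow_mul, ← pow_add]; congr 1; ring
    rw [this, mul_comm K, mul_div_mul_left _ _ (by positivity)]
    gcongr
  have e3 : (T ^ (5 * D)) ^ 2 / (T ^ (6 * D)) ^ 2 ≤ 1 / T := by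
    have : (T ^ (6 * D)) ^ 2 = (T ^ (5 * D)) ^ 2 * T ^ (2 * D) := by
      rw [← pow_mul, ← pow_mul, ← pow_add]; congr 1; ring
    rw [this, ← div_div, div_self (by positivity)]
    gcongr
  have e4 := mul_le_mul_of_nonneg_right e2 hL.le
  have e5 := mul_le_mul_of_nonneg_left e3 hL.le
  calc _ ≤ _ := h1
    _ ≤ 1 / T + K / T * (b - a) + (D * (2 * ((b - a) / T)) + (b - a) * (1 / T)) := by linarith
    _ = _ := by ring

/-- Uniform decay of oscillatory integrals with phase in the span of polynomials that are
linearly independent together with `1`. -/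
theorem exists_norm_integral_exp_le {k : ℕ} (p : Fin k → ℝ[X])
    (hp : LinearIndependent ℝ (Fin.cons 1 p : Fin (k + 1) → ℝ[X])) {a b : ℝ} (hab : a < b) :
    ∃ C δ : ℝ, 0 ≤ C ∧ 0 < δ ∧ δ ≤ 1 ∧ ∀ (c : Fin k → ℝ) (i : Fin k),
      ‖∫ x in a..b, Complex.exp (((∑ j, c j * (p j).eval x : ℝ) : ℂ) * Complex.I)‖ ≤
        C * truncatedNegPow δ (c i) := by
  let Q : (Fin k → ℝ) →ₗ[ℝ] ℝ[X] := Fintype.linearCombination ℝ p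
  have hQ : ∀ c, Q c = ∑ j, c j • p j := fun c => rfl
  have hQe : ∀ c x, (Q c).eval x = ∑ j, c j * (p j).eval x := fun c x => by
    simp [hQ, eval_finsetSum]
  let Φ : (Fin k → ℝ) →ₗ[ℝ] C(Set.Icc a b, ℝ) :=
    (Polynomial.toContinuousMapOnAlgHom (Set.Icc a b)).toLinearMap ∘ₗ derivative ∘ₗ Q
  let Ψ : (Fin k → ℝ) →ₗ[ℝ] C(Set.Icc a b, ℝ) :=
    (Polynomial.toContinuousMapOnAlgHom (Set.Icc a b)).toLinearMap ∘ₗ derivative ∘ₗ derivative ∘ₗ Q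
  have hΦ : ∀ c x, Φ c x = (derivative (Q c)).eval (x : ℝ) := fun c x => rfl
  have hΨ : ∀ c x, Ψ c x = (derivative (derivative (Q c))).eval (x : ℝ) := fun c x => rfl
  -- A combination with zero derivative is a constant, hence a linear relation with the polynomial
  -- 1.
  have hker : LinearMap.ker Φ = ⊥ := by
    rw [LinearMap.ker_eq_bot']
    intro c hc
    have hd : derivative (Q c) = 0 := by
      refine Polynomial.eq_zero_of_infinite_isRoot _ ((Set.Icc_infinite hab).mono fun x hx => ?_)
      have := congrArg (fun f : C(Set.Icc a b, ℝ) => f ⟨x, hx⟩) hc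
      exact this
    obtain ⟨d, hd'⟩ : ∃ d, Q c = C d := ⟨_, Polynomial.eq_C_of_derivative_eq_zero hd⟩
    have := Fintype.linearIndependent_iff.mp hp (Fin.cons (-d) c) (by
      rw [Fin.sum_univ_succ]
      simp only [Fin.cons_zero, Fin.cons_succ]
      rw [← hQ, hd', smul_eq_C_mul]; simp)
    ext i
    simpa using this i.succ
  -- In finite dimension an injective linear map is bounded below and every linear map is bounded.
  -- So the second derivative of the phase is at most `B A` times the sup norm of the first,
  -- uniformly in `c`.
  obtain ⟨A, hA0, hA⟩ := Φ.exists_antilipschitzWith hker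
  have hA' : ∀ c, ‖c‖ ≤ A * ‖Φ c‖ := fun c => by
    have := hA.le_mul_dist c 0
    simpa using this
  have hB : ∀ c, ‖Ψ c‖ ≤ ‖Ψ.toContinuousLinearMap‖ * ‖c‖ := Ψ.toContinuousLinearMap.le_opNorm
  set B := ‖Ψ.toContinuousLinearMap‖ with hBdef
  have hB0 : 0 ≤ B := norm_nonneg Ψ.toContinuousLinearMap
  obtain ⟨D, hD, hdeg⟩ : ∃ D : ℕ, 1 ≤ D ∧ ∀ c, (derivative (Q c)).natDegree ≤ D := by
    refine ⟨(Finset.univ.sup fun j => (p j).natDegree) + 1, by omega, fun c => ?_⟩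
    refine (natDegree_derivative_le _).trans ?_
    have : (Q c).natDegree ≤ Finset.univ.sup fun j => (p j).natDegree := by
      rw [hQ]
      refine natDegree_sum_le_of_forall_le _ _ fun j hj => ?_
      exact (natDegree_smul_le _ _).trans (Finset.le_sup (f := fun j => (p j).natDegree) hj)
    omega
  have hL : 0 < b - a := sub_pos.mpr hab
  set C₀ := 1 + B * A * (b - a) + 2 * D * (b - a) + (b - a) with hC₀
  -- With `T = lam ^ δ` this gives `T ^ (8 * D) = lam`, the normalisation of
  -- `norm_integral_exp_le_div`.
  set δ : ℝ := 1 / (8 * D : ℕ) with hδ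
  have h8D : (1 : ℝ) ≤ (8 * D : ℕ) := by exact_mod_cast (by omega : 1 ≤ 8 * D)
  have hδ0 : 0 < δ := by positivity
  have hA0' : (0 : ℝ) < A := hA0
  have hC₀0 : 0 ≤ C₀ := by positivity
  set C₁ := (A : ℝ) ^ δ * (C₀ + (b - a) * (D + 1)) with hC₁
  have hC₁0 : 0 ≤ C₁ := by positivity
  refine ⟨(b - a) + C₁, δ, by positivity, hδ0, ?_, fun c i => ?_⟩
  · rw [hδ, div_le_one (by linarith)]; exact h8D
  simp_rw [← hQe]
  have htriv : ‖∫ x in a..b, Complex.exp ((((Q c).eval x : ℝ) : ℂ) * Complex.I)‖ ≤ b - a := by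
    have := intervalIntegral.norm_integral_le_of_norm_le_const (a := a) (b := b)
      (f := fun x => Complex.exp ((((Q c).eval x : ℝ) : ℂ) * Complex.I)) (C := 1) fun x _ =>
        (Complex.norm_exp_ofReal_mul_I _).le
    rwa [abs_of_pos hL, one_mul] at this
  by_cases hci : c i = 0
  · rw [truncatedNegPow, if_pos hci, mul_one]
    linarith
  rw [truncatedNegPow, if_neg hci, mul_min_of_nonneg _ _ (by positivity), mul_one]
  refine le_min ?_ (by linarith)
  set lam := ‖Φ c‖ with hlam
  have hcic : |c i| ≤ A * lam := (norm_le_pi_norm c i).trans (hA' c)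
  have hci0 : 0 < |c i| := abs_pos.mpr hci
  have hlam0 : 0 < lam := by
    by_contra! h
    have : (A : ℝ) * lam ≤ 0 := mul_nonpos_of_nonneg_of_nonpos hA0'.le h
    linarith
  set T := lam ^ δ with hT
  have hT0 : 0 < T := by positivity
  have hTpow : T ^ (8 * D) = lam := by
    rw [hT, hδ, one_div]
    exact Real.rpow_inv_natCast_pow hlam0.le (by omega)
  have hTc : (A : ℝ) ^ δ * |c i| ^ (-δ) ≥ 1 / T := by
    have h1 : |c i| ^ δ ≤ (A : ℝ) ^ δ * T := by
      rw [hT, ← Real.mul_rpow hA0'.le hlam0.le]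
      exact Real.rpow_le_rpow hci0.le hcic hδ0.le
    rw [Real.rpow_neg hci0.le, ← div_eq_mul_inv, ge_iff_le, div_le_div_iff₀ hT0 (by positivity)]
    linarith
  have hmain : ‖∫ x in a..b, Complex.exp ((((Q c).eval x : ℝ) : ℂ) * Complex.I)‖ ≤
      (C₀ + (b - a) * (D + 1)) * (1 / T) := by
    by_cases hTD : (D : ℝ) + 1 < T
    · have hT1 : 1 ≤ T := by
        have : (0 : ℝ) ≤ D := Nat.cast_nonneg D
        linarith
      obtain ⟨y, hy⟩ : ∃ y : Set.Icc a b, ‖Φ c y‖ = lam := by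
        have : Nonempty (Set.Icc a b) := ⟨⟨a, Set.left_mem_Icc.mpr hab.le⟩⟩
        obtain ⟨y, -, hy⟩ := isCompact_univ.exists_isMaxOn Set.univ_nonempty
          (Φ c).continuous.norm.continuousOn
        exact ⟨y, le_antisymm (ContinuousMap.norm_coe_le_norm _ _)
          ((ContinuousMap.norm_le _ (norm_nonneg _)).mpr fun z => hy (Set.mem_univ z))⟩
      have hres := norm_integral_exp_le_div (K := B * A) hab hD hT1
        (hTD.trans_le (le_self_pow₀ hT1 (by omega))) (Q c) (hdeg c) y.2
        (by rw [hTpow, ← hy, hΦ]; rfl) (by positivity) (fun x hx => by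
          rw [hTpow]
          calc _ = ‖Ψ c ⟨x, hx⟩‖ := by rw [hΨ]; rfl
            _ ≤ ‖Ψ c‖ := ContinuousMap.norm_coe_le_norm _ _
            _ ≤ B * ‖c‖ := hB c
            _ ≤ B * (A * lam) := by gcongr; exact hA' c
            _ = _ := by ring)
      refine hres.trans ?_
      rw [div_eq_mul_one_div]
      have : 0 ≤ (b - a) * ((D : ℝ) + 1) := by positivity
      exact mul_le_mul_of_nonneg_right (by rw [hC₀]; linarith) (by positivity)
    -- For `T ≤ D + 1` the trivial bound `b - a` is already at most `(b - a)(D + 1) / T`, which is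
    -- why that term was added to the constant.
    · push Not at hTD
      refine htriv.trans ?_
      have h1 : 1 ≤ ((D : ℝ) + 1) * (1 / T) := by
        rw [mul_one_div, le_div_iff₀ hT0]; linarith
      have h2 : b - a ≤ (b - a) * (((D : ℝ) + 1) * (1 / T)) := le_mul_of_one_le_right hL.le h1
      have h3 : 0 ≤ C₀ * (1 / T) := by positivity
      linarith
  calc _ ≤ _ := hmain
    _ ≤ (C₀ + (b - a) * (D + 1)) * ((A : ℝ) ^ δ * |c i| ^ (-δ)) := by gcongr
    _ = C₁ * |c i| ^ (-δ) := by rw [hC₁]; ring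
    _ ≤ _ := mul_le_mul_of_nonneg_right (by linarith) (by positivity)

/-! ### Almost everywhere convergence of exponential averages. -/

lemma truncatedNegPow_le_of_abs_le {δ s t : ℝ} (hδ : 0 < δ) (h : |t| ≤ |s|) :
    truncatedNegPow δ s ≤ truncatedNegPow δ t := by
  unfold truncatedNegPow
  by_cases ht : t = 0
  · rw [if_pos ht]
    split_ifs
    · exact le_rfl
    · exact min_le_right _ _
  · have ht' : 0 < |t| := abs_pos.mpr ht
    have hs : s ≠ 0 := abs_pos.mp (ht'.trans_le h)
    rw [if_neg ht, if_neg hs]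
    exact min_le_min_right _ (Real.rpow_le_rpow_of_nonpos ht' h (by linarith))

/-- Borel–Cantelli in mean. -/
lemma ae_tendsto_zero_of_summable_integral {α : Type*} [MeasurableSpace α] {μ : Measure α}
    (f : ℕ → α → ℝ) (hf0 : ∀ j x, 0 ≤ f j x) (hfi : ∀ j, Integrable (f j) μ)
    (hs : Summable fun j => ∫ x, f j x ∂μ) :
    ∀ᵐ x ∂μ, Tendsto (fun j => f j x) atTop (𝓝 0) := by
  have hlt : ∫⁻ x, ∑' j, ENNReal.ofReal (f j x) ∂μ ≠ ⊤ := by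
    rw [lintegral_tsum fun j => (hfi j).aestronglyMeasurable.aemeasurable.ennreal_ofReal]
    simp_rw [← ofReal_integral_eq_lintegral_ofReal (hfi _) (ae_of_all _ (hf0 _))]
    exact hs.tsum_ofReal_ne_top
  have hae := ae_lt_top' (AEMeasurable.tsum fun j =>
    (hfi j).aestronglyMeasurable.aemeasurable.ennreal_ofReal) hlt
  filter_upwards [hae] with x hx
  have h1 := ENNReal.tendsto_atTop_zero_of_tsum_ne_top hx.ne
  have h2 := (ENNReal.tendsto_toReal ENNReal.zero_ne_top).comp h1
  refine h2.congr fun j => ?_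
  exact ENNReal.toReal_ofReal (hf0 j x)

/-- Adding 1 to every term makes the partial sums monotone, and for monotone sequences convergence
of `u N / N` along such geometric subsequences is enough. -/
lemma tendsto_average_of_tendsto_floor_pow_real (w : ℕ → ℝ) (hw : ∀ n, |w n| ≤ 1)
    (c : ℕ → ℝ) (c1 : ∀ k, 1 < c k) (clim : Tendsto c atTop (𝓝 1))
    (hc : ∀ k, Tendsto (fun j : ℕ => (∑ n ∈ Finset.Icc 1 ⌊c k ^ j⌋₊, w n) / (⌊c k ^ j⌋₊ : ℝ))
      atTop (𝓝 0)) :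
    Tendsto (fun N : ℕ => (∑ n ∈ Finset.Icc 1 N, w n) / (N : ℝ)) atTop (𝓝 0) := by
  set u : ℕ → ℝ := fun N => ∑ n ∈ Finset.Icc 1 N, (1 + w n) with hu
  have hmono : Monotone u := fun M N hMN =>
    Finset.sum_le_sum_of_subset_of_nonneg (Finset.Icc_subset_Icc_right hMN) fun n _ _ => by
      linarith [(abs_le.mp (hw n)).1]
  have heq : ∀ N : ℕ, N ≠ 0 → u N / N = 1 + (∑ n ∈ Finset.Icc 1 N, w n) / (N : ℝ) := fun N hN => by
    have : (N : ℝ) ≠ 0 := by exact_mod_cast hN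
    simp only [hu, Finset.sum_add_distrib, Finset.sum_const, Nat.card_Icc, Nat.add_sub_cancel,
      nsmul_eq_mul, mul_one]
    rw [add_div, div_self this]
  have key := tendsto_div_of_monotone_of_tendsto_div_floor_pow u 1 hmono c c1 clim fun k => by
    have := (hc k).const_add 1
    rw [add_zero] at this
    refine this.congr fun j => (heq _ ?_).symm
    exact (Nat.floor_pos.mpr (one_le_pow₀ (c1 k).le)).ne'
  have key2 := key.sub_const 1
  rw [sub_self] at key2
  refine key2.congr' ?_
  filter_upwards [eventually_ne_atTop 0] with N hN
  rw [heq N hN]; ring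

/-- Convergence of averages along geometric progressions of ratio close to one suffices. -/
lemma tendsto_average_of_tendsto_floor_pow (z : ℕ → ℂ) (hz : ∀ n, ‖z n‖ ≤ 1)
    (c : ℕ → ℝ) (c1 : ∀ k, 1 < c k) (clim : Tendsto c atTop (𝓝 1))
    (hc : ∀ k, Tendsto (fun j : ℕ => (∑ n ∈ Finset.Icc 1 ⌊c k ^ j⌋₊, z n) / (⌊c k ^ j⌋₊ : ℂ))
      atTop (𝓝 0)) :
    Tendsto (fun N : ℕ => (∑ n ∈ Finset.Icc 1 N, z n) / (N : ℂ)) atTop (𝓝 0) := by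
  have hre : ∀ N : ℕ, ((∑ n ∈ Finset.Icc 1 N, z n) / (N : ℂ)).re =
      (∑ n ∈ Finset.Icc 1 N, (z n).re) / (N : ℝ) := fun N => by
    rw [Complex.div_natCast_re, Complex.re_sum]
  have him : ∀ N : ℕ, ((∑ n ∈ Finset.Icc 1 N, z n) / (N : ℂ)).im =
      (∑ n ∈ Finset.Icc 1 N, (z n).im) / (N : ℝ) := fun N => by
    rw [Complex.div_natCast_im, Complex.im_sum]
  have h1 := tendsto_average_of_tendsto_floor_pow_real (fun n => (z n).re)
    (fun n => (Complex.abs_re_le_norm _).trans (hz n)) c c1 clim fun k =>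
      ((Complex.continuous_re.tendsto 0).comp (hc k)).congr fun j => hre _
  have h2 := tendsto_average_of_tendsto_floor_pow_real (fun n => (z n).im)
    (fun n => (Complex.abs_im_le_norm _).trans (hz n)) c c1 clim fun k =>
      ((Complex.continuous_im.tendsto 0).comp (hc k)).congr fun j => him _
  have h3 := ((Complex.continuous_ofReal.tendsto 0).comp h1).add
    (((Complex.continuous_ofReal.tendsto 0).comp h2).mul_const Complex.I)
  simp only [Complex.ofReal_zero, zero_mul, add_zero] at h3
  refine h3.congr fun N => ?_
  simp only [Function.comp]
  rw [← hre, ← him, Complex.re_add_im]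

lemma norm_sq_sum_exp (t : ℕ → ℝ) (N : ℕ) :
    ‖∑ n ∈ Finset.Icc 1 N, Complex.exp ((t n : ℂ) * Complex.I)‖ ^ 2 =
      N + 2 * ∑ n ∈ Finset.Icc 1 N, ∑ m ∈ Finset.Ico 1 n, Real.cos (t n - t m) := by
  induction N with
  | zero => simp
  | succ N ih =>
    rw [Finset.sum_Icc_succ_top (by omega), Finset.sum_Icc_succ_top (by omega),
      ← Complex.normSq_eq_norm_sq, Complex.normSq_add, Complex.normSq_eq_norm_sq,
      Complex.normSq_eq_norm_sq, ih, Complex.norm_exp_ofReal_mul_I, Finset.sum_mul, Complex.re_sum]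
    have : ∀ n, (Complex.exp ((t n : ℂ) * Complex.I) *
        (starRingEnd ℂ) (Complex.exp ((t (N + 1) : ℂ) * Complex.I))).re =
        Real.cos (t (N + 1) - t n) := fun n => by
      rw [← Complex.exp_conj, ← Complex.exp_add, ← Real.cos_neg, ← Complex.exp_ofReal_mul_I_re]
      congr 2
      simp only [map_mul, Complex.conj_ofReal, Complex.conj_I]
      push_cast; ring
    simp_rw [this]
    have hI : Finset.Icc 1 N = Finset.Ico 1 (N + 1) := by
      ext
      simp only [Finset.mem_Icc, Finset.mem_Ico]
      omega
    rw [← hI]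
    push_cast; ring

/-- The square expands into a diagonal contribution `N` and cosines of phase differences; each
cosine is the real part of an exponential. -/
lemma integral_norm_sq_sum_exp_le (θ : ℕ → ℝ → ℝ) (hθ : ∀ n, Continuous (θ n)) {a b : ℝ}
    (hab : a ≤ b) (N : ℕ) :
    ∫ x in Set.Icc a b, ‖∑ n ∈ Finset.Icc 1 N, Complex.exp ((θ n x : ℂ) * Complex.I)‖ ^ 2 ≤
      N * (b - a) + 2 * ∑ n ∈ Finset.Icc 1 N, ∑ m ∈ Finset.Ico 1 n,
        ‖∫ x in a..b, Complex.exp (((θ n x - θ m x : ℝ) : ℂ) * Complex.I)‖ := by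
  simp_rw [norm_sq_sum_exp]
  have hi : ∀ n m, Integrable (fun x => Real.cos (θ n x - θ m x)) (volume.restrict (Set.Icc a b)) :=
    fun n m => (Real.continuous_cos.comp ((hθ n).sub (hθ m))).continuousOn.integrableOn_Icc
  have hi2 : ∀ n, Integrable (fun x => ∑ m ∈ Finset.Ico 1 n, Real.cos (θ n x - θ m x))
      (volume.restrict (Set.Icc a b)) := fun n => integrable_finsetSum _ fun m _ => hi n m
  rw [integral_add (integrable_const _) ((integrable_finsetSum _ fun n _ => hi2 n).const_mul 2),
    integral_const_mul, integral_finsetSum _ fun n _ => hi2 n]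
  refine add_le_add (by simp [hab, mul_comm]) ?_
  refine mul_le_mul_of_nonneg_left (Finset.sum_le_sum fun n _ => ?_) (by norm_num)
  rw [integral_finsetSum _ fun m _ => hi n m]
  refine Finset.sum_le_sum fun m _ => ?_
  rw [integral_Icc_eq_integral_Ioc, ← intervalIntegral.integral_of_le hab]
  refine le_trans (le_of_eq ?_) (Complex.re_le_norm _)
  have hint : IntervalIntegrable (fun x => Complex.exp (((θ n x - θ m x : ℝ) : ℂ) * Complex.I))
      volume a b := by
    refine Continuous.intervalIntegrable ?_ a b
    exact Complex.continuous_exp.comp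
      ((Complex.continuous_ofReal.comp ((hθ n).sub (hθ m))).mul continuous_const)
  have := Complex.reCLM.intervalIntegral_comp_comm hint
  simp only [Complex.reCLM_apply, Complex.exp_ofReal_mul_I_re] at this
  exact this

/-- From `⌊c^j⌋ ≥ (1 - 1/c) c^j`, the logarithm is at least `j log c` plus a constant, and half of
`j log c` eventually absorbs the constant. -/
lemma eventually_mul_le_log_floor_pow {c : ℝ} (hc : 1 < c) :
    ∀ᶠ j : ℕ in atTop, j * (Real.log c / 2) ≤ Real.log (⌊c ^ j⌋₊ : ℝ) := by
  have hlc : 0 < Real.log c := Real.log_pos hc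
  have hc0 : 0 < c := by linarith
  have h1c : 0 < 1 - c⁻¹ := sub_pos.mpr (inv_lt_one_of_one_lt₀ hc)
  have hlim : Tendsto (fun j : ℕ => (j : ℝ) * (Real.log c / 2)) atTop atTop :=
    tendsto_natCast_atTop_atTop.atTop_mul_const (by positivity)
  filter_upwards [hlim.eventually_ge_atTop (-Real.log (1 - c⁻¹))] with j hj
  have h1 := Real.log_le_log (by positivity) (mul_pow_le_nat_floor_pow hc j)
  rw [Real.log_mul h1c.ne' (by positivity), Real.log_pow] at h1
  linarith

/-- A Davenport–Erdős–LeVeque type criterion. -/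
theorem ae_tendsto_average_exp (θ : ℕ → ℝ → ℝ) (hθ : ∀ n, Continuous (θ n)) {a b C ε : ℝ}
    (hab : a ≤ b) (hε : 0 < ε) (hC : 0 ≤ C)
    (hbound : ∀ᶠ N : ℕ in atTop, 1 / (N : ℝ) ^ 2 * ∑ n ∈ Finset.Icc 1 N, ∑ m ∈ Finset.Ico 1 n,
      ‖∫ x in a..b, Complex.exp (((θ n x - θ m x : ℝ) : ℂ) * Complex.I)‖ ≤
        C * (1 / Real.log N ^ (1 + ε))) :
    ∀ᵐ x ∂(volume.restrict (Set.Icc a b)), Tendsto (fun N : ℕ =>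
      (∑ n ∈ Finset.Icc 1 N, Complex.exp ((θ n x : ℂ) * Complex.I)) / (N : ℂ)) atTop (𝓝 0) := by
  set S : ℕ → ℝ → ℂ := fun N x => ∑ n ∈ Finset.Icc 1 N, Complex.exp ((θ n x : ℂ) * Complex.I) with hS
  have hScont : ∀ N, Continuous (S N) := fun N => continuous_finsetSum _ fun n _ =>
    Complex.continuous_exp.comp ((Complex.continuous_ofReal.comp (hθ n)).mul continuous_const)
  have hgeo : ∀ c : ℝ, 1 < c → ∀ᵐ x ∂(volume.restrict (Set.Icc a b)),
      Tendsto (fun j : ℕ => S ⌊c ^ j⌋₊ x / (⌊c ^ j⌋₊ : ℂ)) atTop (𝓝 0) := by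
    intro c hc
    have hlc : 0 < Real.log c := Real.log_pos hc
    have hc0 : 0 < c := by linarith
    have h1c : 0 < 1 - c⁻¹ := sub_pos.mpr (inv_lt_one_of_one_lt₀ hc)
    have hfloor : Tendsto (fun j : ℕ => ⌊c ^ j⌋₊) atTop atTop :=
      tendsto_nat_floor_atTop.comp (tendsto_pow_atTop_atTop_of_one_lt hc)
    -- The geometric series majorises the diagonal `1/N`; the series in `1 / j^(1+ε)` majorises the
    -- pair correlations, as `log N` is at least of order `j`.
    have hsum : Summable fun j : ℕ => (b - a) * (1 - c⁻¹)⁻¹ * c⁻¹ ^ j +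
        2 * C * (1 / (Real.log c / 2) ^ (1 + ε)) * (1 / (j : ℝ) ^ (1 + ε)) := by
      refine Summable.add ?_ ?_
      · exact (summable_geometric_of_lt_one (by positivity) (inv_lt_one_of_one_lt₀ hc)).mul_left _
      · exact (Real.summable_one_div_nat_rpow.mpr (by linarith)).mul_left _
    have hcont : ∀ j : ℕ, Continuous fun x => ‖S ⌊c ^ j⌋₊ x / (⌊c ^ j⌋₊ : ℂ)‖ ^ 2 := fun j =>
      ((hScont _).div_const _).norm.pow 2
    have hae := ae_tendsto_zero_of_summable_integral (μ := volume.restrict (Set.Icc a b))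
      (fun j x => ‖S ⌊c ^ j⌋₊ x / (⌊c ^ j⌋₊ : ℂ)‖ ^ 2) (fun j x => by positivity)
      (fun j => (hcont j).continuousOn.integrableOn_Icc) (by
        refine Summable.of_norm_bounded_eventually_nat hsum ?_
        filter_upwards [hfloor.eventually hbound, eventually_mul_le_log_floor_pow hc,
          eventually_gt_atTop 0] with j hj hlog hj0
        rw [Real.norm_of_nonneg (integral_nonneg fun x => by positivity)]
        set N := ⌊c ^ j⌋₊ with hN
        have hNpos : 0 < (N : ℝ) := by
          exact_mod_cast Nat.floor_pos.mpr (one_le_pow₀ hc.le)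
        have hNge := mul_pow_le_nat_floor_pow hc j
        rw [← hN] at hNge
        have hj0' : (0 : ℝ) < j := by exact_mod_cast hj0
        simp_rw [norm_div, div_pow, Complex.norm_natCast]
        rw [integral_div]
        have hI := integral_norm_sq_sum_exp_le θ hθ hab N
        have e1 : 1 / (N : ℝ) ≤ (1 - c⁻¹)⁻¹ * c⁻¹ ^ j := by
          rw [inv_pow, ← mul_inv, one_div]
          exact inv_anti₀ (by positivity) hNge
        have e2 : 1 / Real.log N ^ (1 + ε) ≤
            (1 / (Real.log c / 2) ^ (1 + ε)) * (1 / (j : ℝ) ^ (1 + ε)) := by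
          rw [div_mul_div_comm, one_mul, ← Real.mul_rpow (by positivity) hj0'.le, mul_comm _ (j : ℝ)]
          refine one_div_le_one_div_of_le (by positivity) ?_
          exact Real.rpow_le_rpow (by positivity) hlog (by linarith)
        calc _ ≤ _ := div_le_div_of_nonneg_right hI (by positivity)
          _ = (b - a) * (1 / N) + 2 * (1 / (N : ℝ) ^ 2 * ∑ n ∈ Finset.Icc 1 N,
              ∑ m ∈ Finset.Ico 1 n,
              ‖∫ x in a..b, Complex.exp (((θ n x - θ m x : ℝ) : ℂ) * Complex.I)‖) := by
            set Z := ∑ n ∈ Finset.Icc 1 N, ∑ m ∈ Finset.Ico 1 n,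
              ‖∫ x in a..b, Complex.exp (((θ n x - θ m x : ℝ) : ℂ) * Complex.I)‖
            field_simp
          _ ≤ (b - a) * ((1 - c⁻¹)⁻¹ * c⁻¹ ^ j) + 2 * (C * ((1 / (Real.log c / 2) ^ (1 + ε)) *
              (1 / (j : ℝ) ^ (1 + ε)))) := by
            refine add_le_add (mul_le_mul_of_nonneg_left e1 (sub_nonneg.mpr hab)) ?_
            refine mul_le_mul_of_nonneg_left (hj.trans ?_) (by norm_num)
            exact mul_le_mul_of_nonneg_left e2 hC
          _ = _ := by ring)
    filter_upwards [hae] with x hx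
    rw [tendsto_zero_iff_norm_tendsto_zero]
    have := hx.sqrt
    simpa only [Real.sqrt_sq (norm_nonneg _), Real.sqrt_zero] using this
  -- Countably many ratios `1 + 1/(k+1)`, decreasing to 1, keep the exceptional set null.
  have hall : ∀ᵐ x ∂(volume.restrict (Set.Icc a b)), ∀ k : ℕ,
      Tendsto (fun j : ℕ => S ⌊(1 + 1 / ((k : ℝ) + 1)) ^ j⌋₊ x /
        (⌊(1 + 1 / ((k : ℝ) + 1)) ^ j⌋₊ : ℂ)) atTop (𝓝 0) :=
    ae_all_iff.mpr fun k => hgeo _ (by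
      have : (0 : ℝ) < 1 / ((k : ℝ) + 1) := by positivity
      linarith)
  filter_upwards [hall] with x hx
  refine tendsto_average_of_tendsto_floor_pow _ (fun n => (Complex.norm_exp_ofReal_mul_I _).le)
    (fun k : ℕ => 1 + 1 / ((k : ℝ) + 1)) (fun k => ?_) ?_ hx
  · have : (0 : ℝ) < 1 / ((k : ℝ) + 1) := by positivity
    linarith
  · simpa using tendsto_one_div_add_atTop_nhds_zero_nat.const_add (1 : ℝ)

/-! ### Independence implies equidistribution almost everywhere. -/

/-- The decay estimate may be read off any single coefficient, so one index `i` with `h i ≠ 0`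
suffices and no joint condition on the sequences is needed. -/
theorem ae_tendsto_weyl_average {k : ℕ} (p : Fin k → ℝ[X])
    (hp : LinearIndependent ℝ (Fin.cons 1 p : Fin (k + 1) → ℝ[X])) (s : Fin k → ℕ → ℝ)
    (hs : ∀ i, IsScattered (s i)) (h : Fin k → ℤ) (hh : h ≠ 0) {a b : ℝ} (hab : a < b) :
    ∀ᵐ x ∂(volume.restrict (Set.Icc a b)), Tendsto (fun N : ℕ =>
      (∑ n ∈ Finset.Icc 1 N, Complex.exp (((2 * Real.pi * ∑ i, h i * (s i n * (p i).eval x) : ℝ) : ℂ) *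
        Complex.I)) / (N : ℂ)) atTop (𝓝 0) := by
  obtain ⟨C, δ, hC, hδ0, hδ1, hdecay⟩ := exists_norm_integral_exp_le p hp hab
  obtain ⟨i, hi⟩ := Function.ne_iff.mp hh
  obtain ⟨ε, hε, hsc⟩ := hs i δ hδ0 hδ1
  refine ae_tendsto_average_exp (fun n x => 2 * Real.pi * ∑ i, h i * (s i n * (p i).eval x))
    (fun n => by fun_prop) hab.le hε hC ?_
  filter_upwards [hsc] with N hN
  have hterm : ∀ n m, ‖∫ x in a..b, Complex.exp (((2 * Real.pi * ∑ i, h i * (s i n * (p i).eval x) -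
      2 * Real.pi * ∑ i, h i * (s i m * (p i).eval x) : ℝ) : ℂ) * Complex.I)‖ ≤
        C * truncatedNegPow δ (s i n - s i m) := fun n m => by
    have h1 := hdecay (fun j => 2 * Real.pi * h j * (s j n - s j m)) i
    refine le_trans (le_of_eq ?_) (h1.trans ?_)
    · congr 1
      refine intervalIntegral.integral_congr fun x _ => ?_
      congr 3
      rw [Finset.mul_sum, Finset.mul_sum, ← Finset.sum_sub_distrib]
      exact Finset.sum_congr rfl fun j _ => by ring
    -- The factor `2π |h i|` is at least 1, and enlarging the argument only decreases
    -- `truncatedNegPow`.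
    · refine mul_le_mul_of_nonneg_left (truncatedNegPow_le_of_abs_le hδ0 ?_) hC
      rw [abs_mul]
      refine le_mul_of_one_le_left (abs_nonneg _) ?_
      rw [abs_mul, abs_of_pos Real.two_pi_pos]
      have h2 : (1 : ℝ) ≤ |(h i : ℝ)| := by exact_mod_cast Int.one_le_abs hi
      nlinarith [Real.pi_gt_three]
  calc _ ≤ 1 / (N : ℝ) ^ 2 * ∑ n ∈ Finset.Icc 1 N, ∑ m ∈ Finset.Ico 1 n,
        C * truncatedNegPow δ (s i n - s i m) := by
        refine mul_le_mul_of_nonneg_left ?_ (by positivity)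
        exact Finset.sum_le_sum fun n _ => Finset.sum_le_sum fun m _ => hterm n m
    _ = C * (1 / (N : ℝ) ^ 2 * ∑ n ∈ Finset.Icc 1 N, ∑ m ∈ Finset.Ico 1 n,
        truncatedNegPow δ (s i n - s i m)) := by
        simp_rw [← Finset.mul_sum]; ring
    _ ≤ _ := mul_le_mul_of_nonneg_left hN hC

theorem ae_uniformlyDistributedModOne {k : ℕ} (p : Fin k → ℝ[X])
    (hp : LinearIndependent ℝ (Fin.cons 1 p : Fin (k + 1) → ℝ[X])) (s : Fin k → ℕ → ℝ)
    (hs : ∀ i, IsScattered (s i)) :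
    ∀ᵐ x ∂(volume : Measure ℝ), UniformlyDistributedModOne (fun n i => s i n * (p i).eval x) := by
  -- The quantifiers over `R` and `h` are countable; the summand 1 keeps the interval nondegenerate
  -- at `R = 0`.
  have hall : ∀ᵐ x ∂(volume : Measure ℝ), ∀ (R : ℕ) (h : Fin k → ℤ), h ≠ 0 →
      x ∈ Set.Icc (-((R : ℝ) + 1)) (R + 1) → Tendsto (fun N : ℕ =>
      (∑ n ∈ Finset.Icc 1 N, Complex.exp (((2 * Real.pi * ∑ i, h i * (s i n * (p i).eval x) : ℝ) : ℂ) *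
        Complex.I)) / (N : ℂ)) atTop (𝓝 0) := by
    refine ae_all_iff.mpr fun R => ae_all_iff.mpr fun h => ?_
    by_cases hh : h = 0
    · exact ae_of_all _ fun x hne => absurd hh hne
    · have hR : -((R : ℝ) + 1) < R + 1 := by
        have : (0 : ℝ) ≤ R := Nat.cast_nonneg R
        linarith
      filter_upwards [(ae_restrict_iff' measurableSet_Icc).mp
        (ae_tendsto_weyl_average p hp s hs h hh hR)] with x hx _ using hx
  filter_upwards [hall] with x hx
  refine uniformlyDistributedModOne_of_weyl _ fun h hh => hx ⌈|x|⌉₊ h hh ?_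
  have := Nat.le_ceil |x|
  rw [Set.mem_Icc, ← abs_le]
  linarith

/-! ### Dependence gives a counterexample. -/

/-- Used with `ε = 1`: a sequence whose pair sums stay bounded as `N` grows is scattered. -/
lemma eventually_log_rpow_le (C : ℝ) :
    ∀ᶠ N : ℕ in atTop, C / N ≤ 1 / Real.log N ^ ((1 : ℝ) + 1) := by
  have h := (isLittleO_log_rpow_rpow_atTop (s := 1) ((1 : ℝ) + 1) one_pos).bound
    (c := 1 / (|C| + 1)) (by positivity)
  filter_upwards [tendsto_natCast_atTop_atTop.eventually h, eventually_gt_atTop 1] with N hN hN1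
  have hN1' : (1 : ℝ) < N := by exact_mod_cast hN1
  have hlog : 0 < Real.log N := Real.log_pos hN1'
  rw [Real.rpow_one, Real.norm_of_nonneg (by positivity), Real.norm_of_nonneg (by positivity),
    one_div_mul_eq_div, le_div_iff₀ (by positivity)] at hN
  rw [div_le_div_iff₀ (by positivity) (by positivity), one_mul]
  have h1 : C ≤ |C| + 1 := by linarith [le_abs_self C]
  have h2 : 0 ≤ Real.log N ^ ((1 : ℝ) + 1) := by positivity
  nlinarith

/-- Nonzero multiples of the powers of two are scattered. -/
lemma isScattered_mul_two_pow {α : ℝ} (hα : α ≠ 0) : IsScattered fun n => α * 2 ^ n := by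
  intro δ hδ _
  set r : ℝ := 2 ^ (-δ) with hr
  have hr0 : 0 < r := by positivity
  have hr1 : r < 1 := Real.rpow_lt_one_of_one_lt_of_neg (by norm_num) (by linarith)
  set A : ℝ := |α / 2| ^ (-δ) with hA
  have hα2 : 0 < |α / 2| := abs_pos.mpr (by simpa using hα)
  have hsum : Summable fun n : ℕ => (n : ℝ) * r ^ n := by
    simpa using summable_pow_mul_geometric_of_norm_lt_one 1 (by rwa [Real.norm_of_nonneg hr0.le])
  -- For `m < n` the gap is at least half of the larger term, so the pair sum is dominated by the
  -- convergent series `A ∑ n r^n`.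
  have hterm : ∀ n m : ℕ, m < n → truncatedNegPow δ (α * 2 ^ n - α * 2 ^ m) ≤ A * r ^ n := by
    intro n m hmn
    have hge : |α / 2| * 2 ^ n ≤ |α * 2 ^ n - α * 2 ^ m| := by
      have h1 : (2 : ℝ) ^ m * 2 ≤ 2 ^ n := by
        rw [← pow_succ]; exact pow_le_pow_right₀ (by norm_num) hmn
      have h2 : (0 : ℝ) < 2 ^ m := by positivity
      have h3 : (0 : ℝ) ≤ 2 ^ n - 2 ^ m := by linarith
      rw [← mul_sub, abs_mul, abs_div, abs_of_pos (two_pos (α := ℝ)), abs_of_nonneg h3]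
      have := mul_le_mul_of_nonneg_left h1 (abs_nonneg α)
      linarith
    have hpos : 0 < |α / 2| * 2 ^ n := by positivity
    have hne : α * 2 ^ n - α * 2 ^ m ≠ 0 := abs_pos.mp (hpos.trans_le hge)
    rw [truncatedNegPow, if_neg hne]
    refine (min_le_left _ _).trans ((Real.rpow_le_rpow_of_nonpos hpos hge (by linarith)).trans_eq ?_)
    rw [Real.mul_rpow hα2.le (by positivity), hA, hr, ← Real.rpow_natCast, ← Real.rpow_natCast,
      ← Real.rpow_mul (by norm_num), ← Real.rpow_mul (by norm_num), mul_comm (n : ℝ)]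
  have hA0 : 0 ≤ A := by positivity
  refine ⟨1, one_pos, ?_⟩
  filter_upwards [eventually_log_rpow_le (A * ∑' n : ℕ, (n : ℝ) * r ^ n), eventually_gt_atTop 0]
    with N hN hN0
  have hN0' : (1 : ℝ) ≤ N := by exact_mod_cast hN0
  refine le_trans ?_ hN
  have hS : ∑ n ∈ Finset.Icc 1 N, ∑ m ∈ Finset.Ico 1 n,
      truncatedNegPow δ (α * 2 ^ n - α * 2 ^ m) ≤ A * ∑' n : ℕ, (n : ℝ) * r ^ n := by
    calc _ ≤ ∑ n ∈ Finset.Icc 1 N, A * ((n : ℝ) * r ^ n) := by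
          refine Finset.sum_le_sum fun n _ => ?_
          refine (Finset.sum_le_card_nsmul _ _ (A * r ^ n) fun m hm =>
            hterm n m (Finset.mem_Ico.mp hm).2).trans ?_
          rw [nsmul_eq_mul, Nat.card_Ico]
          have : ((n - 1 : ℕ) : ℝ) ≤ n := by exact_mod_cast Nat.sub_le n 1
          have h0 : 0 ≤ A * r ^ n := by positivity
          nlinarith
      _ ≤ _ := by
          rw [← Finset.mul_sum]
          exact mul_le_mul_of_nonneg_left
            (hsum.sum_le_tsum _ fun n _ => by positivity) hA0
  have hT0 : 0 ≤ A * ∑' n : ℕ, (n : ℝ) * r ^ n :=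
    mul_nonneg hA0 (tsum_nonneg fun n => by positivity)
  calc _ ≤ 1 / (N : ℝ) ^ 2 * (A * ∑' n : ℕ, (n : ℝ) * r ^ n) :=
        mul_le_mul_of_nonneg_left hS (by positivity)
    _ ≤ 1 / (N : ℝ) * (A * ∑' n : ℕ, (n : ℝ) * r ^ n) := by
        refine mul_le_mul_of_nonneg_right ?_ hT0
        exact one_div_le_one_div_of_le (by positivity) (le_self_pow₀ hN0' (by norm_num))
    _ = _ := by ring

/-- A sequence on which a nonempty subsum of the coordinates is integral is not uniformly
distributed. -/
lemma not_uniformlyDistributedModOne_of_sum_int {k : ℕ} (y : ℕ → Fin k → ℝ) (S : Finset (Fin k))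
    (hS : S.Nonempty) (hy : ∀ n, ∃ z : ℤ, ∑ i ∈ S, y n i = z) :
    ¬ UniformlyDistributedModOne y := by
  intro hud
  have hSk : S.card ≤ k := by simpa using S.card_le_univ
  have hS0 : (1 : ℝ) ≤ S.card := by exact_mod_cast hS.card_pos
  have hSk' : (S.card : ℝ) ≤ k := by exact_mod_cast hSk
  have hk : (0 : ℝ) < k := by linarith
  -- On the box `[β, 2β]^k` the fractional parts over `S` sum to a number between `β > 0` and `2kβ =
  -- 2/3`, hence never to an integer.
  set β : ℝ := 1 / (3 * k) with hβ
  have hβ0 : 0 < β := by positivity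
  have hkβ : k * β = 1 / 3 := by rw [hβ]; field_simp
  have hβ1 : 2 * β ≤ 1 := by nlinarith
  have h := hud (fun _ => Set.Icc β (2 * β)) fun i =>
    ⟨Set.ordConnected_Icc, Set.Icc_subset_Icc hβ0.le hβ1⟩
  have hempty : ∀ N : ℕ, {n : ℕ | n ∈ Finset.Icc 1 N ∧ (fun i => Int.fract (y n i)) ∈
      Set.univ.pi fun _ : Fin k => Set.Icc β (2 * β)} = ∅ := by
    intro N
    rw [Set.eq_empty_iff_forall_notMem]
    rintro n ⟨-, hn⟩
    obtain ⟨z, hz⟩ := hy n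
    have h1 : S.card * β ≤ ∑ i ∈ S, Int.fract (y n i) := by
      rw [← nsmul_eq_mul]
      exact Finset.card_nsmul_le_sum _ _ _ fun i _ => (hn i trivial).1
    have h2 : ∑ i ∈ S, Int.fract (y n i) ≤ S.card * (2 * β) := by
      rw [← nsmul_eq_mul]
      exact Finset.sum_le_card_nsmul _ _ _ fun i _ => (hn i trivial).2
    have h3 : ∑ i ∈ S, Int.fract (y n i) = ((z - ∑ i ∈ S, ⌊y n i⌋ : ℤ) : ℝ) := by
      push_cast
      rw [← hz, ← Finset.sum_sub_distrib]
      rfl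
    rw [h3] at h1 h2
    have h4 : (0 : ℝ) < ((z - ∑ i ∈ S, ⌊y n i⌋ : ℤ) : ℝ) := by nlinarith
    have h5 : ((z - ∑ i ∈ S, ⌊y n i⌋ : ℤ) : ℝ) < 1 := by nlinarith
    have h6 : 0 < z - ∑ i ∈ S, ⌊y n i⌋ := by exact_mod_cast h4
    have h7 : z - ∑ i ∈ S, ⌊y n i⌋ < 1 := by exact_mod_cast h5
    omega
  simp only [hempty, Set.ncard_empty, Nat.cast_zero, zero_div] at h
  have h0 := tendsto_nhds_unique h tendsto_const_nhds
  rw [Measure.real, volume_pi_pi] at h0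
  simp only [Real.volume_Icc, Finset.prod_const, ENNReal.toReal_pow] at h0
  rw [ENNReal.toReal_ofReal (by linarith)] at h0
  have : 0 < (2 * β - β) ^ (Finset.univ : Finset (Fin k)).card := pow_pos (by linarith) _
  linarith

theorem exists_scattered_of_not_linearIndependent {k : ℕ} (p : Fin k → ℝ[X])
    (hp : ¬ LinearIndependent ℝ (Fin.cons 1 p : Fin (k + 1) → ℝ[X])) :
    ∃ s : Fin k → ℕ → ℝ, (∀ i, IsScattered (s i)) ∧
      ∀ x : ℝ, ¬ UniformlyDistributedModOne (fun n i => s i n * (p i).eval x) := by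
  classical
  obtain ⟨g, hg, j, hj⟩ := Fintype.not_linearIndependent_iff.mp hp
  rw [Fin.sum_univ_succ] at hg
  simp only [Fin.cons_zero, Fin.cons_succ] at hg
  have hev : ∀ x : ℝ, ∑ i : Fin k, g i.succ * (p i).eval x = -g 0 := fun x => by
    have := congrArg (eval x) hg
    simp only [eval_add, eval_smul, eval_one, eval_finsetSum, smul_eq_mul, mul_one, eval_zero] at this
    linarith
  set S : Finset (Fin k) := Finset.univ.filter fun i => g i.succ ≠ 0 with hS
  -- If only `g 0` could be nonzero, the relation would force it to vanish as well.
  have hSne : S.Nonempty := by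
    by_contra hne
    rw [Finset.not_nonempty_iff_eq_empty, Finset.filter_eq_empty_iff] at hne
    have h0 : ∀ i : Fin k, g i.succ = 0 := fun i => not_not.mp (hne (Finset.mem_univ i))
    have h1 := hev 0
    simp only [h0, zero_mul, Finset.sum_const_zero] at h1
    refine hj ?_
    refine Fin.cases ?_ h0 j
    linarith
  obtain ⟨d, hd, z₀, hz₀⟩ : ∃ d : ℝ, d ≠ 0 ∧ ∃ z : ℤ, d * g 0 = z := by
    by_cases h0 : g 0 = 0
    · exact ⟨1, one_ne_zero, 0, by simp [h0]⟩
    · exact ⟨(g 0)⁻¹, inv_ne_zero h0, 1, by simp [h0]⟩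
  -- Where the coefficient vanishes, the zero sequence would not be scattered, so `2^n` is used;
  -- these indices lie outside `S`. Over `S` the coordinates sum to `-d g_0 2^n`, an integer
  -- independent of `x`.
  refine ⟨fun i n => (if g i.succ = 0 then 1 else d * g i.succ) * 2 ^ n, fun i => ?_, fun x => ?_⟩
  · refine isScattered_mul_two_pow ?_
    split_ifs with h
    · exact one_ne_zero
    · exact mul_ne_zero hd h
  · refine not_uniformlyDistributedModOne_of_sum_int _ S hSne fun n => ⟨-(z₀ * 2 ^ n), ?_⟩
    have h1 : ∑ i ∈ S, (if g i.succ = 0 then 1 else d * g i.succ) * 2 ^ n * (p i).eval x =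
        ∑ i : Fin k, d * 2 ^ n * (g i.succ * (p i).eval x) := by
      rw [hS, Finset.sum_filter]
      refine Finset.sum_congr rfl fun i _ => ?_
      by_cases h : g i.succ = 0
      · simp [h]
      · simp only [ne_eq, h, not_false_eq_true, if_true, if_false]; ring
    rw [h1, ← Finset.mul_sum, hev]
    push_cast
    rw [← hz₀]; ring

theorem mainTheorem7 (k : ℕ) (hk : 1 ≤ k) (p : Fin k → ℝ[X]) :
    LinearIndependent ℝ (Fin.cons 1 p : Fin (k + 1) → ℝ[X]) ↔
      ∀ a : Fin k → ℕ → ℝ, (∀ i, IsScattered (a i)) →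
        ∀ᵐ x ∂(volume : Measure ℝ),
          UniformlyDistributedModOne (fun n i => a i n * (p i).eval x) := by
  refine ⟨fun hp a ha => ae_uniformlyDistributedModOne p hp a ha, fun h => ?_⟩
  by_contra hp
  obtain ⟨s, hs, hnot⟩ := exists_scattered_of_not_linearIndependent p hp
  obtain ⟨x, hx⟩ := (h s hs).exists
  exact hnot x hx
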